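/- Let $m,n\ge 1$ be integers and let $p,q>0$ be real. Let $\mathcal S$ be the set of all real tuples $(\{\phi_j\}_{j=1}^m,\{\psi_j\}_{j=1}^m,\{\theta_k\}_{k=1}^{2mn})$ such that $\phi_1=0$ and, for $j=1,\dots,m$ and with $\phi_{m+1}=2\pi$, $$\phi_j<\theta_{2(j-1)n+1}<\cdots<\theta_{(2j-1)n}<\psi_j<\theta_{(2j-1)n+1}<\cdots<\theta_{2jn}<\phi_{j+1}.$$ On $\mathcal S$ define $$\begin{aligned}\tilde H={}&p\sum_{j=1}^m\sum_{k=1}^{2mn}\log|e^{i\phi_j}-e^{i\theta_k}|+q\sum_{j=1}^m\sum_{k=1}^{2mn}\log|e^{i\psi_j}-e^{i\theta_k}|+\sum_{1\le k<j\le 2mn}\log|e^{i\theta_j}-e^{i\theta_k}|\\&+p^2\sum_{1\le k<j\le m}\log|e^{i\phi_j}-e^{i\phi_k}|+q^2\sum_{1\le k<j\le m}\log|e^{i\psi_j}-e^{i\psi_k}|+pq\sum_{1\le j,k\le m}\log|e^{i\phi_j}-e^{i\psi_k}|.\end{aligned}$$ Then $\mathcal S$ is convex, and $\tilde H$ attains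 its maximum on $\mathcal S$ at exactly one point of $\mathcal S$. Moreover, a point of $\mathcal S$ is a maximizer of $\tilde H$ on $\mathcal S$ if and only if $\{e^{i\phi_j}\}_{j=1}^m$ is the set of $m$-th roots of $1$, $\{e^{i\psi_j}\}_{j=1}^m$ is the set of $m$-th roots of $-1$, and $\{e^{i\theta_k}\}_{k=1}^{2mn}$ is the set of complex zeros of the polynomial $$z^{mn}P_n^{(p-1/2,\,q-1/2)}\!\left(\frac{z^m+z^{-m}}{2}\right),$$ where $P_n^{(\alpha,\beta)}$ denotes the Jacobi polynomial of degree $n$. -/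

import Mathlib

open Polynomial

noncomputable section

/-- The Jacobi polynomial `P_n^{(α,β)}`, through the classical formula
`∑_ν (n+α+β+1)⋯(n+α+β+ν) (α+ν+1)⋯(α+n) / (ν! (n-ν)!) ((x-1)/2)^ν`,
which is polynomial in `α`, `β` and so needs no restriction on the parameters. -/
def jacobiPoly (n : ℕ) (α β : ℝ) : ℝ[X] :=
  ∑ ν ∈ Finset.range (n + 1),
    C ((ascPochhammer ℝ ν).eval (n + α + β + 1) * (ascPochhammer ℝ (n - ν)).eval (α + ν + 1)
        / ((ν.factorial : ℝ) * ((n - ν).factorial : ℝ)))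
      * (C (1 / 2 : ℝ) * (X - 1)) ^ ν

/-- The polynomial `z^{mn} P((z^m + z^{-m})/2)`, for a real polynomial `P = ∑_{k ≤ n} a_k x^k`,
with denominators cleared:
`z^{mn} ((z^m + z^{-m})/2)^k = z^{m(n-k)} ((z^{2m} + 1)/2)^k`. -/
def circlePoly (m n : ℕ) (P : ℝ[X]) : ℂ[X] :=
  ∑ k ∈ Finset.range (n + 1),
    C (P.coeff k : ℂ) * X ^ (m * (n - k)) * (C (1 / 2 : ℂ) * (X ^ (2 * m) + 1)) ^ k

theorem circlePoly_eval (m n : ℕ) (P : ℝ[X]) (hP : P.natDegree ≤ n) (z : ℂ) (hz : z ≠ 0) :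
    (circlePoly m n P).eval z = z ^ (m * n) * aeval (z ^ m / 2 + 1 / (2 * z ^ m)) P := by
  rw [aeval_eq_sum_range' (Nat.lt_succ_of_le hP), circlePoly, eval_finsetSum, Finset.mul_sum]
  refine Finset.sum_congr rfl fun k hk => ?_
  have hk' : k ≤ n := Nat.lt_succ_iff.mp (Finset.mem_range.mp hk)
  have hw : z ^ m ≠ 0 := pow_ne_zero _ hz
  have h2 : (1 / 2 : ℂ) * (z ^ (2 * m) + 1) = z ^ m * (z ^ m / 2 + 1 / (2 * z ^ m)) := by
    rw [two_mul, pow_add]; field_simp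
  have h3 : z ^ (m * n) = z ^ (m * (n - k)) * (z ^ m) ^ k := by
    rw [← pow_mul, ← pow_add, ← Nat.mul_add, Nat.sub_add_cancel hk']
  simp only [eval_mul, eval_pow, eval_add, eval_C, eval_X, eval_one]
  rw [h2, h3, mul_pow, Complex.real_smul]
  ring

theorem jacobiPoly_natDegree_le (n : ℕ) (α β : ℝ) : (jacobiPoly n α β).natDegree ≤ n := by
  refine natDegree_sum_le_of_forall_le _ _ fun ν hν => ?_
  refine (natDegree_C_mul_le _ _).trans (natDegree_pow_le.trans ?_)
  have h : (C (1 / 2 : ℝ) * (X - 1)).natDegree ≤ 1 :=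
    (natDegree_C_mul_le _ _).trans (natDegree_X_sub_C_le 1)
  have := Finset.mem_range.mp hν
  calc ν * _ ≤ ν * 1 := Nat.mul_le_mul_left _ h
    _ ≤ n := by omega

/-- The point `e^{it}` of the unit circle. -/
def circPt (t : ℝ) : ℂ := Complex.exp (t * Complex.I)

/-- Triples `(φ, ψ, θ)` of angles: `m` of charge `p`, `m` of charge `q` and `2mn` of charge `1`.
Indices start at `0`. -/
abbrev Config (m n : ℕ) : Type :=
  (Fin m → ℝ) × (Fin m → ℝ) × (Fin (2 * m * n) → ℝ)

/-- The angle that follows `φ j`, with the convention that `2π` follows the last one. -/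
def nextAngle {m : ℕ} (φ : Fin m → ℝ) (j : Fin m) : ℝ :=
  if h : (j : ℕ) + 1 < m then φ ⟨j + 1, h⟩ else 2 * Real.pi

/-- The configuration space: the first angle `φ` is `0`, the `θ`'s increase, the `j`-th block of
`2n` of them is split so that `n` lie between `φ j` and `ψ j`, and the next `n` lie between `ψ j`
and the angle following `φ j`. -/
def configSpace (m n : ℕ) : Set (Config m n) :=
  {x | (∀ j : Fin m, (j : ℕ) = 0 → x.1 j = 0) ∧
    StrictMono x.2.2 ∧
    (∀ (j : Fin m) (k : Fin (2 * m * n)), 2 * (j : ℕ) * n ≤ k → (k : ℕ) < (2 * j + 1) * n →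
      x.1 j < x.2.2 k ∧ x.2.2 k < x.2.1 j) ∧
    (∀ (j : Fin m) (k : Fin (2 * m * n)), (2 * (j : ℕ) + 1) * n ≤ k → (k : ℕ) < (2 * j + 2) * n →
      x.2.1 j < x.2.2 k ∧ x.2.2 k < nextAngle x.1 j)}

/-- The Hamiltonian of a configuration, with charges `p`, `q` and `1`. -/
def hamiltonian (m n : ℕ) (p q : ℝ) (x : Config m n) : ℝ :=
  p * ∑ j, ∑ k, Real.log ‖circPt (x.1 j) - circPt (x.2.2 k)‖
  + q * ∑ j, ∑ k, Real.log ‖circPt (x.2.1 j) - circPt (x.2.2 k)‖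
  + ∑ j, ∑ k ∈ Finset.Iio j, Real.log ‖circPt (x.2.2 j) - circPt (x.2.2 k)‖
  + p ^ 2 * ∑ j, ∑ k ∈ Finset.Iio j, Real.log ‖circPt (x.1 j) - circPt (x.1 k)‖
  + q ^ 2 * ∑ j, ∑ k ∈ Finset.Iio j, Real.log ‖circPt (x.2.1 j) - circPt (x.2.1 k)‖
  + p * q * ∑ j, ∑ k, Real.log ‖circPt (x.1 j) - circPt (x.2.1 k)‖

end

/-! Since `|e^{is} - e^{it}| = 2 |sin ((s - t) / 2)|` and `log ∘ sin` is strictly concave on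
`(0, π)`, and since all configurations have their particles in `[0, 2π)` in the same order, a
configuration at which every particle feels zero total force `∑ w_b cot ((x_a - x_b) / 2)` is the
only maximizer.

If `f` is a trigonometric polynomial with simple zeros `x_b`, then `f` is a constant multiple of
`∏ sin ((t - x_b) / 2)`, so the `x_b` exert the force `2 f' / f` at a point that is not one of them
and `f'' / f'` on one of their own. For the `θ`'s of the theorem `f t = P_n (cos (m t))`; at
multiples of `π / m`, where the `φ`'s and `ψ`'s are, `f' = 0`, and at the zeros of `f` the balance
of forces is the differential equation of the Jacobi polynomial. Rolle's theorem, applied to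
`(1 - x)^{α+1} (1 + x)^{β+1} P_n^{(α+1,β+1)}`, whose derivative is a multiple of
`(1 - x)^α (1 + x)^β P_{n+1}^{(α,β)}`, provides inductively `n` zeros of `P_n` in `(-1, 1)`, hence
a configuration of the required form.
-/

/-- The coefficient of `((x - 1) / 2) ^ ν` in `P_n^{(α,β)}`, meaningful for `ν ≤ n` only. -/
noncomputable def jacobiCoeff (n : ℕ) (α β : ℝ) (ν : ℕ) : ℝ :=
  (ascPochhammer ℝ ν).eval (n + α + β + 1) * (ascPochhammer ℝ (n - ν)).eval (α + ν + 1)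
    / ((ν.factorial : ℝ) * ((n - ν).factorial : ℝ))

/-- The Jacobi polynomial in the variable `y = (x - 1) / 2`, in which it is a sum of monomials. -/
noncomputable def shiftedJacobiPoly (n : ℕ) (α β : ℝ) : ℝ[X] :=
  ∑ ν ∈ Finset.range (n + 1), C (jacobiCoeff n α β ν) * X ^ ν

theorem jacobiPoly_eq_shiftedJacobiPoly_comp (n : ℕ) (α β : ℝ) :
    jacobiPoly n α β = (shiftedJacobiPoly n α β).comp (C (1 / 2) * (X - 1)) := by
  simp [jacobiPoly, shiftedJacobiPoly, jacobiCoeff]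

theorem coeff_shiftedJacobiPoly (n : ℕ) (α β : ℝ) (ν : ℕ) :
    (shiftedJacobiPoly n α β).coeff ν = if ν ≤ n then jacobiCoeff n α β ν else 0 := by
  simp [shiftedJacobiPoly, coeff_X_pow]

theorem ascPochhammer_succ_eval_left {R : Type*} [CommSemiring R] (n : ℕ) (x : R) :
    (ascPochhammer R (n + 1)).eval x = x * (ascPochhammer R n).eval (x + 1) := by
  simp [ascPochhammer_succ_left, eval_comp]

section Recurrences

variable (n : ℕ) (α β : ℝ)

theorem succ_mul_jacobiCoeff_succ {ν : ℕ} :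
    (ν + 1) * jacobiCoeff (n + 1) α β (ν + 1) =
      (n + α + β + 2) * jacobiCoeff n (α + 1) (β + 1) ν := by
  have hα : α + (ν + 1) + 1 = α + 1 + ν + 1 := by ring
  have hn : (n : ℝ) + 1 + α + β + 1 + 1 = n + (α + 1) + (β + 1) + 1 := by ring
  simp only [jacobiCoeff, Nat.add_sub_add_right, ascPochhammer_succ_eval_left ν,
    Nat.factorial_succ, Nat.cast_add, Nat.cast_mul, Nat.cast_one, hα, hn]
  field_simp
  ring

theorem jacobiCoeff_raise_zero :
    (n + 1) * jacobiCoeff (n + 1) α β 0 = (α + 1) * jacobiCoeff n (α + 1) (β + 1) 0 := by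
  simp only [jacobiCoeff, Nat.sub_zero, ascPochhammer_zero, eval_one, Nat.factorial_zero,
    ascPochhammer_succ_eval_left, Nat.factorial_succ, Nat.cast_add, Nat.cast_mul, Nat.cast_one,
    Nat.cast_zero, add_zero]
  field_simp

theorem jacobiCoeff_raise_succ {ν : ℕ} (hν : ν < n) :
    (n + 1) * jacobiCoeff (n + 1) α β (ν + 1) =
      (α + 1 + (ν + 1)) * jacobiCoeff n (α + 1) (β + 1) (ν + 1)
        + (α + β + 2 + ν) * jacobiCoeff n (α + 1) (β + 1) ν := by
  obtain ⟨k, rfl⟩ := Nat.exists_eq_add_of_lt hν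
  have hα : α + (ν + 1) + 1 = α + 1 + ν + 1 := by ring
  have hn : (ν : ℝ) + k + 1 + 1 + α + β + 1 + 1 = ν + k + 1 + (α + 1) + (β + 1) + 1 := by ring
  have hα' : α + 1 + ((ν : ℝ) + 1) + 1 = α + 1 + ν + 1 + 1 := by ring
  simp only [jacobiCoeff, show ν + k + 1 + 1 - (ν + 1) = k + 1 by lia,
    show ν + k + 1 - (ν + 1) = k by lia, show ν + k + 1 - ν = k + 1 by lia,
    Nat.factorial_succ, Nat.cast_add, Nat.cast_mul, Nat.cast_one]
  rw [ascPochhammer_succ_eval_left ν, ascPochhammer_succ_eval ν, hn, hα, hα',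
    ascPochhammer_succ_eval_left k]
  field_simp
  ring

theorem jacobiCoeff_raise_last :
    (n + 1) * jacobiCoeff (n + 1) α β (n + 1) =
      (α + β + 2 + n) * jacobiCoeff n (α + 1) (β + 1) n := by
  rw [succ_mul_jacobiCoeff_succ]
  ring

theorem shiftedJacobiPoly_derivative :
    derivative (shiftedJacobiPoly (n + 1) α β) =
      C (n + α + β + 2) * shiftedJacobiPoly n (α + 1) (β + 1) := by
  ext ν
  rw [coeff_derivative, coeff_C_mul, coeff_shiftedJacobiPoly, coeff_shiftedJacobiPoly]
  by_cases hν : ν ≤ n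
  · rw [if_pos hν, if_pos (by lia), mul_comm, succ_mul_jacobiCoeff_succ]
  · rw [if_neg hν, if_neg (by lia), zero_mul, mul_zero]

theorem shiftedJacobiPoly_raise :
    (C (α + 1) + C (α + β + 2) * X) * shiftedJacobiPoly n (α + 1) (β + 1)
        + (X + X ^ 2) * derivative (shiftedJacobiPoly n (α + 1) (β + 1)) =
      C (n + 1 : ℝ) * shiftedJacobiPoly (n + 1) α β := by
  set K := shiftedJacobiPoly n (α + 1) (β + 1) with hK
  have coeff_euler (ν : ℕ) : (X * derivative K).coeff ν = ν * K.coeff ν := by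
    rcases ν with _ | ν
    · simp
    · rw [coeff_X_mul, coeff_derivative, mul_comm, Nat.cast_succ]
  have expand : (C (α + 1) + C (α + β + 2) * X) * K + (X + X ^ 2) * derivative K =
      C (α + 1) * K + X * derivative K + X * (C (α + β + 2) * K + X * derivative K) := by ring
  rw [expand]
  ext ν
  rcases ν with _ | ν
  · simp only [coeff_add, coeff_C_mul, coeff_X_mul_zero, add_zero, hK, coeff_shiftedJacobiPoly,
      Nat.zero_le, if_true, jacobiCoeff_raise_zero]
  · rw [coeff_add, coeff_add, coeff_euler, coeff_X_mul, coeff_add, coeff_euler]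
    simp only [coeff_C_mul, hK, coeff_shiftedJacobiPoly, Nat.cast_succ]
    rcases lt_trichotomy ν n with hν | rfl | hν
    · rw [if_pos (by lia), if_pos (by lia), if_pos (by lia), jacobiCoeff_raise_succ n α β hν]
      ring
    · rw [if_neg (by lia), if_pos le_rfl, if_pos le_rfl, jacobiCoeff_raise_last]
      ring
    · rw [if_neg (by lia), if_neg (by lia), if_neg (by lia)]
      ring

theorem jacobiPoly_derivative :
    derivative (jacobiPoly (n + 1) α β) =
      C ((n + α + β + 2) / 2) * jacobiPoly n (α + 1) (β + 1) := by
  have hC : C ((n + α + β + 2) / 2) = C (1 / 2 : ℝ) * C (n + α + β + 2) := by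
    rw [← C_mul]
    ring_nf
  simp only [jacobiPoly_eq_shiftedJacobiPoly_comp, derivative_comp, shiftedJacobiPoly_derivative,
    mul_comp, C_comp, derivative_C_mul, derivative_sub, derivative_X, derivative_one, sub_zero,
    mul_one, hC, mul_assoc]

theorem jacobiPoly_raise :
    (C (β - α) - C (α + β + 2) * X) * jacobiPoly n (α + 1) (β + 1)
        + (1 - X ^ 2) * derivative (jacobiPoly n (α + 1) (β + 1)) =
      C (-2 * (n + 1 : ℝ)) * jacobiPoly (n + 1) α β := by
  have hC : 2 * C (1 / 2 : ℝ) = 1 := by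
    rw [← C_ofNat, ← C_mul]
    norm_num
  have h := congrArg (comp · (C (1 / 2) * (X - 1))) (shiftedJacobiPoly_raise n α β)
  simp only [add_comp, mul_comp, C_comp, X_comp, pow_comp] at h
  simp only [jacobiPoly_eq_shiftedJacobiPoly_comp, derivative_comp, derivative_C_mul,
    derivative_sub, derivative_X, derivative_one, sub_zero, mul_one]
  generalize (shiftedJacobiPoly n (α + 1) (β + 1)).comp _ = K at *
  generalize (derivative (shiftedJacobiPoly n (α + 1) (β + 1))).comp _ = K' at *
  simp only [C_mul, C_add, C_sub, C_neg, C_ofNat, C_1] at h ⊢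
  linear_combination (-2) * h + ((C α + C β + 2) * (X - 1) * K
    + C (1 / 2) * (X - 1) ^ 2 * K') * hC

end Recurrences

theorem jacobiPoly_ode (n : ℕ) (α β : ℝ) :
    (1 - X ^ 2) * derivative (derivative (jacobiPoly n α β))
        + (C (β - α) - C (α + β + 2) * X) * derivative (jacobiPoly n α β)
        + C (n * (n + α + β + 1)) * jacobiPoly n α β = 0 := by
  rcases n with _ | n
  · simp [jacobiPoly]
  have h := jacobiPoly_raise n α β
  rw [jacobiPoly_derivative, derivative_C_mul]
  have h2 : C (((n + 1 : ℕ) : ℝ) * ((n + 1 : ℕ) + α + β + 1)) =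
      -(C ((n + α + β + 2) / 2) * C (-2 * (n + 1 : ℝ))) := by
    rw [← C_mul, ← C_neg]
    push_cast
    ring_nf
  rw [h2]
  linear_combination C ((n + α + β + 2) / 2) * h

theorem jacobiPoly_eval_one_pos (n : ℕ) {α : ℝ} (β : ℝ) (hα : -1 < α) :
    0 < (jacobiPoly n α β).eval 1 := by
  have h : (jacobiPoly n α β).eval 1 = jacobiCoeff n α β 0 := by
    rw [jacobiPoly_eq_shiftedJacobiPoly_comp, eval_comp, eval_mul, eval_sub, eval_X, eval_one,
      sub_self, mul_zero, ← coeff_zero_eq_eval_zero, coeff_shiftedJacobiPoly, if_pos n.zero_le]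
  rw [h, jacobiCoeff, ascPochhammer_zero, eval_one, one_mul]
  have hpos : 0 < (ascPochhammer ℝ (n - 0)).eval (α + (0 : ℕ) + 1) :=
    ascPochhammer_pos _ _ (by push_cast; linarith)
  positivity

theorem exists_strictMono_mem_Ioo_eq_zero {n : ℕ} {e : Fin (n + 2) → ℝ} (he : StrictMono e)
    {g g' : ℝ → ℝ} (hg : Continuous g) (hg0 : ∀ i, g (e i) = 0)
    (hg' : ∀ x ∈ Set.Ioo (e 0) (e (Fin.last _)), HasDerivAt g (g' x) x) :
    ∃ z : Fin (n + 1) → ℝ, StrictMono z ∧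
      ∀ i, z i ∈ Set.Ioo (e 0) (e (Fin.last _)) ∧ g' (z i) = 0 := by
  have subset (i : Fin (n + 1)) :
      Set.Ioo (e i.castSucc) (e i.succ) ⊆ Set.Ioo (e 0) (e (Fin.last _)) :=
    Set.Ioo_subset_Ioo (he.monotone (Fin.zero_le _)) (he.monotone (Fin.le_last _))
  have rolle (i : Fin (n + 1)) : ∃ c ∈ Set.Ioo (e i.castSucc) (e i.succ), g' c = 0 :=
    exists_hasDerivAt_eq_zero (he Fin.castSucc_lt_succ) hg.continuousOn
      ((hg0 _).trans (hg0 _).symm) fun x hx => hg' x (subset i hx)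
  choose z hz hz' using rolle
  refine ⟨z, Fin.strictMono_iff_lt_succ.2 fun i => ?_, fun i => ⟨subset i (hz i), hz' i⟩⟩
  exact (hz i.castSucc).2.trans (Fin.succ_castSucc i ▸ (hz i.succ).1)

theorem strictMono_cons_snoc {E : Type*} [Preorder E] {n : ℕ} {z : Fin n → E} (hz : StrictMono z)
    {a b : E} (hab : a < b) (hmem : ∀ i, z i ∈ Set.Ioo a b) :
    StrictMono (Fin.cons a (Fin.snoc z b : Fin (n + 1) → E) : Fin (n + 2) → E) := by
  intro i j hij
  induction j using Fin.cases with
  | zero => exact absurd hij (Fin.not_lt_zero i)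
  | succ j =>
    induction i using Fin.cases <;> induction j using Fin.lastCases
    case zero.last => simpa using hab
    case zero.cast j => simpa using (hmem j).1
    case succ.last i =>
      induction i using Fin.lastCases with
      | last => exact absurd hij (lt_irrefl _)
      | cast i => simpa using (hmem i).2
    case succ.cast i j =>
      induction i using Fin.lastCases with
      | last => exact absurd (Fin.succ_lt_succ_iff.1 hij) (Fin.le_last _).not_gt
      | cast i => simpa using hz (by simpa using hij)

theorem hasDerivAt_jacobi_weight_mul (n : ℕ) (α β : ℝ) {x : ℝ} (hx : x ∈ Set.Ioo (-1) 1) :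
    HasDerivAt
      (fun x => (1 - x) ^ (α + 1) * (1 + x) ^ (β + 1) * (jacobiPoly n (α + 1) (β + 1)).eval x)
      ((1 - x) ^ α * (1 + x) ^ β * (-2 * (n + 1) * (jacobiPoly (n + 1) α β).eval x)) x := by
  have h1 : 0 < 1 - x := by linarith [hx.2]
  have h2 : 0 < 1 + x := by linarith [hx.1]
  have d1 : HasDerivAt (fun x : ℝ => (1 - x) ^ (α + 1)) (-1 * (α + 1) * (1 - x) ^ α) x := by
    simpa using ((hasDerivAt_id x).const_sub 1).rpow_const (p := α + 1) (Or.inl h1.ne')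
  have d2 : HasDerivAt (fun x : ℝ => (1 + x) ^ (β + 1)) (1 * (β + 1) * (1 + x) ^ β) x := by
    simpa using ((hasDerivAt_id x).const_add 1).rpow_const (p := β + 1) (Or.inl h2.ne')
  refine ((d1.mul d2).mul (Polynomial.hasDerivAt _ x)).congr_deriv ?_
  have raise := congrArg (eval x) (jacobiPoly_raise n α β)
  simp only [eval_add, eval_mul, eval_sub, eval_C, eval_X, eval_one, eval_pow] at raise
  simp only [← raise, Real.rpow_add h1, Real.rpow_add h2, Real.rpow_one, Pi.mul_apply]
  ring

theorem exists_strictMono_jacobiPoly_roots (n : ℕ) {α β : ℝ} (hα : -1 < α) (hβ : -1 < β) :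
    ∃ z : Fin n → ℝ, StrictMono z ∧
      ∀ i, z i ∈ Set.Ioo (-1) 1 ∧ (jacobiPoly n α β).eval (z i) = 0 := by
  induction n generalizing α β with
  | zero => exact ⟨Fin.elim0, fun i => i.elim0, fun i => i.elim0⟩
  | succ n ih =>
    obtain ⟨z, hz, hz0⟩ := ih (by linarith : -1 < α + 1) (by linarith : -1 < β + 1)
    have continuous_weight_mul : Continuous fun x : ℝ =>
        (1 - x) ^ (α + 1) * (1 + x) ^ (β + 1) * (jacobiPoly n (α + 1) (β + 1)).eval x :=
      (((continuous_const.sub continuous_id).rpow_const fun _ => .inr (by linarith)).mul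
        ((continuous_const.add continuous_id).rpow_const fun _ => .inr (by linarith))).mul
        (Polynomial.continuous _)
    obtain ⟨y, hy, hy0⟩ := exists_strictMono_mem_Ioo_eq_zero
      (strictMono_cons_snoc hz (by norm_num) fun i => (hz0 i).1) continuous_weight_mul
      (fun i => by
        refine Fin.cases ?_ (Fin.lastCases ?_ fun i => ?_) i
        · simp [Real.zero_rpow (by linarith : β + 1 ≠ 0)]
        · simp [Real.zero_rpow (by linarith : α + 1 ≠ 0)]
        · simp [(hz0 i).2])
      (fun x hx => hasDerivAt_jacobi_weight_mul n α β (by simpa [← Fin.succ_last] using hx))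
    refine ⟨y, hy, fun i => ?_⟩
    have hmem : y i ∈ Set.Ioo (-1) 1 := by simpa [← Fin.succ_last] using (hy0 i).1
    have h1 := (Real.rpow_pos_of_pos (sub_pos.2 hmem.2) α).ne'
    have h2 := (Real.rpow_pos_of_pos (by linarith [hmem.1] : 0 < 1 + y i) β).ne'
    have h3 : -2 * ((n : ℝ) + 1) ≠ 0 := mul_ne_zero (by norm_num) n.cast_add_one_ne_zero
    exact ⟨hmem, by simpa only [mul_eq_zero, h1, h2, h3, false_or] using (hy0 i).2⟩

section Circle

theorem circPt_zero : circPt 0 = 1 := by simp [circPt]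

theorem circPt_pi : circPt Real.pi = -1 := by rw [circPt, Complex.exp_pi_mul_I]

theorem circPt_im (t : ℝ) : (circPt t).im = Real.sin t := Complex.exp_ofReal_mul_I_im t

theorem circPt_ne_zero (t : ℝ) : circPt t ≠ 0 := Complex.exp_ne_zero _

theorem norm_circPt (t : ℝ) : ‖circPt t‖ = 1 := Complex.norm_exp_ofReal_mul_I t

theorem circPt_add (s t : ℝ) : circPt (s + t) = circPt s * circPt t := by
  simp only [circPt, Complex.ofReal_add, add_mul, Complex.exp_add]

theorem circPt_pow (t : ℝ) (m : ℕ) : circPt t ^ m = circPt (m * t) := by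
  simp only [circPt, ← Complex.exp_nat_mul, Complex.ofReal_mul, Complex.ofReal_natCast, mul_assoc]

theorem circPt_sub_circPt_neg (t : ℝ) :
    circPt t - circPt (-t) = 2 * Complex.I * Real.sin t := by
  rw [Complex.ofReal_sin, circPt, circPt, Complex.ofReal_neg, mul_right_comm, Complex.two_sin,
    mul_assoc, Complex.I_mul_I]
  ring

theorem circPt_sub_circPt (s t : ℝ) :
    circPt s - circPt t = circPt ((s + t) / 2) * (2 * Complex.I * Real.sin ((s - t) / 2)) := by
  rw [← circPt_sub_circPt_neg, mul_sub, ← circPt_add, ← circPt_add]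
  congr 2 <;> ring

theorem norm_circPt_sub (s t : ℝ) : ‖circPt s - circPt t‖ = 2 * |Real.sin ((s - t) / 2)| := by
  rw [circPt_sub_circPt, norm_mul, norm_circPt, one_mul, norm_mul, norm_mul, Complex.norm_ofNat,
    Complex.norm_I, Complex.norm_real, mul_one, Real.norm_eq_abs]

theorem circPt_eq_circPt_iff {s t : ℝ} :
    circPt s = circPt t ↔ Real.sin ((s - t) / 2) = 0 := by
  rw [← sub_eq_zero, ← norm_eq_zero, norm_circPt_sub]
  simp

theorem abs_half_sub_lt_pi {s t : ℝ} (hs : s ∈ Set.Ico 0 (2 * Real.pi))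
    (ht : t ∈ Set.Ico 0 (2 * Real.pi)) : |(s - t) / 2| < Real.pi :=
  abs_lt.2 ⟨by linarith [hs.1, ht.2], by linarith [hs.2, ht.1]⟩

theorem injOn_circPt : Set.InjOn circPt (Set.Ico 0 (2 * Real.pi)) := by
  intro s hs t ht hst
  have h := abs_lt.1 (abs_half_sub_lt_pi hs ht)
  rw [circPt_eq_circPt_iff, Real.sin_eq_zero_iff_of_lt_of_lt h.1 h.2] at hst
  linarith

theorem circPt_div_two_add (t : ℝ) : circPt t / 2 + 1 / (2 * circPt t) = Real.cos t := by
  rw [Complex.ofReal_cos, Complex.cos, circPt, neg_mul, Complex.exp_neg]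
  field_simp

end Circle

section PolynomialRoots

variable {ι K : Type*} [Fintype ι] [Field K] {R : K[X]} {z : ι → K}

theorem eq_C_mul_prod_X_sub_C (hz : Function.Injective z) (hdeg : R.natDegree ≤ Fintype.card ι)
    (hroot : ∀ i, R.eval (z i) = 0) : R = C R.leadingCoeff * ∏ i, (X - C (z i)) := by
  refine eq_leadingCoeff_mul_of_monic_of_dvd_of_natDegree_le (monic_prod_X_sub_C _ _) ?_ ?_
  · exact Finset.prod_dvd_of_coprime (fun i _ j _ hij => pairwise_coprime_X_sub_C hz hij)
      fun i _ => dvd_iff_isRoot.2 (hroot i)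
  · simpa [natDegree_prod_of_monic, monic_X_sub_C] using hdeg

theorem range_eq_setOf_eval_eq_zero (hz : Function.Injective z) (hR : R ≠ 0)
    (hdeg : R.natDegree ≤ Fintype.card ι) (hroot : ∀ i, R.eval (z i) = 0) :
    Set.range z = {w | R.eval w = 0} := by
  refine Set.Subset.antisymm (Set.range_subset_iff.2 hroot) fun w (hw : R.eval w = 0) => ?_
  rw [eq_C_mul_prod_X_sub_C hz hdeg hroot, eval_C_mul, eval_prod, mul_eq_zero,
    Finset.prod_eq_zero_iff] at hw
  obtain ⟨i, -, hi⟩ := hw.resolve_left (leadingCoeff_ne_zero.2 hR)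
  exact ⟨i, by simpa [sub_eq_zero, eq_comm] using hi⟩

end PolynomialRoots

section HalfAngleSines

variable {ι : Type*}

theorem logDeriv_sin_half_sub (u t : ℝ) :
    logDeriv (fun t => Real.sin ((t - u) / 2)) t = Real.cot ((t - u) / 2) / 2 := by
  have h : HasDerivAt (fun t => (t - u) / 2) (1 / 2) t :=
    ((hasDerivAt_id t).sub_const u).div_const 2
  change logDeriv (Real.sin ∘ fun t => (t - u) / 2) t = _
  rw [logDeriv_comp Real.differentiableAt_sin h.differentiableAt, Real.logDeriv_sin, h.deriv]
  ring

theorem sum_cot_half_sub {s : Finset ι} {x : ι → ℝ} {t : ℝ}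
    (h : ∀ i ∈ s, Real.sin ((t - x i) / 2) ≠ 0) :
    ∑ i ∈ s, Real.cot ((t - x i) / 2) =
      2 * logDeriv (fun t => ∏ i ∈ s, Real.sin ((t - x i) / 2)) t := by
  rw [logDeriv_prod h fun i _ => by fun_prop, Finset.mul_sum]
  exact Finset.sum_congr rfl fun i _ => by rw [logDeriv_sin_half_sub]; ring

theorem deriv_sin_half_sub_mul {g : ℝ → ℝ} (hg : ContDiff ℝ 2 g) {c u t : ℝ}
    (ht : Real.sin ((t - u) / 2) = 0) :
    deriv (fun t => c * (Real.sin ((t - u) / 2) * g t)) t = c * Real.cos ((t - u) / 2) * g t / 2 ∧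
      deriv (deriv fun t => c * (Real.sin ((t - u) / 2) * g t)) t =
        c * Real.cos ((t - u) / 2) * deriv g t := by
  have d (t : ℝ) : HasDerivAt (fun t => (t - u) / 2) (1 / 2) t :=
    ((hasDerivAt_id t).sub_const u).div_const 2
  have dg (t : ℝ) : HasDerivAt g (deriv g t) t := (hg.differentiable two_ne_zero t).hasDerivAt
  have dg' : HasDerivAt (deriv g) (deriv (deriv g) t) t :=
    ((hg.deriv' (n := 1)).differentiable one_ne_zero t).hasDerivAt
  have d1 (t : ℝ) : HasDerivAt (fun t => c * (Real.sin ((t - u) / 2) * g t))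
      (c * (Real.cos ((t - u) / 2) * (1 / 2) * g t + Real.sin ((t - u) / 2) * deriv g t)) t :=
    ((d t).sin.mul (dg t)).const_mul c
  have d2 := ((((d t).cos.mul_const (1 / 2)).mul (dg t)).add ((d t).sin.mul dg')).const_mul c
  rw [funext fun t => (d1 t).deriv]
  refine ⟨by simp only [ht]; ring, d2.deriv.trans ?_⟩
  simp only [ht]
  ring

variable [Fintype ι]

theorem sum_cot_half_sub_of_ne_zero {x : ι → ℝ} {c : ℝ} {f : ℝ → ℝ}
    (hf : f = fun t => c * ∏ i, Real.sin ((t - x i) / 2)) {t : ℝ} (ht : f t ≠ 0) :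
    ∑ i, Real.cot ((t - x i) / 2) = 2 * logDeriv f t := by
  subst hf
  rw [logDeriv_const_mul _ _ (left_ne_zero_of_mul ht)]
  exact sum_cot_half_sub (Finset.prod_ne_zero_iff.1 (right_ne_zero_of_mul ht))

theorem sum_cot_half_sub_of_eq_zero {x : ι → ℝ} (hx : Function.Injective fun i => circPt (x i))
    {c : ℝ} (hc : c ≠ 0) {f : ℝ → ℝ} (hf : f = fun t => c * ∏ i, Real.sin ((t - x i) / 2))
    {t : ℝ} (ht : f t = 0) :
    deriv f t ≠ 0 ∧ ∑ i, Real.cot ((t - x i) / 2) = deriv (deriv f) t / deriv f t := by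
  classical
  obtain ⟨a, -, ha⟩ : ∃ a ∈ Finset.univ, Real.sin ((t - x a) / 2) = 0 := by
    rw [hf] at ht
    exact Finset.prod_eq_zero_iff.1 ((mul_eq_zero.1 ht).resolve_left hc)
  set g : ℝ → ℝ := fun t => ∏ i ∈ Finset.univ.erase a, Real.sin ((t - x i) / 2)
  have split_off : f = fun t => c * (Real.sin ((t - x a) / 2) * g t) := by
    rw [hf]
    exact funext fun t => congrArg (c * ·) (Finset.mul_prod_erase _ _ (Finset.mem_univ a)).symm
  have hg_smooth : ContDiff ℝ 2 g := by fun_prop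
  have hne : ∀ b ∈ Finset.univ.erase a, Real.sin ((t - x b) / 2) ≠ 0 :=
    fun b hb h => Finset.ne_of_mem_erase hb <| hx <|
      (circPt_eq_circPt_iff.2 h).symm.trans (circPt_eq_circPt_iff.2 ha)
  have hg0 : g t ≠ 0 := Finset.prod_ne_zero_iff.2 hne
  have hcos : Real.cos ((t - x a) / 2) ≠ 0 := by
    rcases Real.sin_eq_zero_iff_cos_eq.1 ha with h | h <;> simp [h]
  have sum_erase : ∑ b ∈ Finset.univ.erase a, Real.cot ((t - x b) / 2) = 2 * logDeriv g t :=
    sum_cot_half_sub hne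
  obtain ⟨d1, d2⟩ := deriv_sin_half_sub_mul hg_smooth (c := c) ha
  rw [split_off, d1, d2]
  refine ⟨div_ne_zero (mul_ne_zero (mul_ne_zero hc hcos) hg0) two_ne_zero, ?_⟩
  -- the summand of `a` is a division by zero, so only the factor `g` of `f` counts
  rw [← Finset.add_sum_erase _ _ (Finset.mem_univ a), Real.cot_eq_cos_div_sin, ha, div_zero,
    zero_add, sum_erase, logDeriv_apply]
  field_simp

theorem exists_eq_mul_prod_sin {x : ι → ℝ} (hx : Function.Injective fun i => circPt (x i))
    {R : ℂ[X]} (hdeg : R.natDegree ≤ Fintype.card ι) (hroot : ∀ i, R.eval (circPt (x i)) = 0)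
    {f : ℝ → ℝ} (hf : ∀ t, R.eval (circPt t) = circPt (Fintype.card ι * t / 2) * f t)
    {t₀ : ℝ} (ht₀ : f t₀ ≠ 0) :
    ∃ c ≠ 0, f = fun t => c * ∏ i, Real.sin ((t - x i) / 2) := by
  set d : ℂ := R.leadingCoeff * ∏ i, (circPt (x i / 2) * (2 * Complex.I)) with hd
  have prod_sub (t : ℝ) : ∏ i, (circPt t - circPt (x i)) = circPt (Fintype.card ι * t / 2) *
      ((∏ i, (circPt (x i / 2) * (2 * Complex.I))) * (∏ i, Real.sin ((t - x i) / 2) : ℝ)) := by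
    rw [mul_div_assoc, ← circPt_pow, ← Finset.card_univ, ← Finset.prod_const, Complex.ofReal_prod,
      ← Finset.prod_mul_distrib, ← Finset.prod_mul_distrib]
    refine Finset.prod_congr rfl fun i _ => ?_
    rw [circPt_sub_circPt, add_div, circPt_add]
    ring
  have factor (t : ℝ) : (f t : ℂ) = d * (∏ i, Real.sin ((t - x i) / 2) : ℝ) := by
    refine mul_left_cancel₀ (circPt_ne_zero (Fintype.card ι * t / 2)) ?_
    rw [← hf, eq_C_mul_prod_X_sub_C hx hdeg hroot, eval_C_mul, eval_prod]
    simp only [eval_sub, eval_X, eval_C, prod_sub, hd]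
    ring
  have real (t : ℝ) : f t = d.re * ∏ i, Real.sin ((t - x i) / 2) := by
    rw [← Complex.ofReal_re (f t), factor, Complex.re_mul_ofReal]
  exact ⟨d.re, fun h => ht₀ (by rw [real, h, zero_mul]), funext real⟩

end HalfAngleSines

section CirclePoly

theorem circlePoly_natDegree_le (m n : ℕ) (P : ℝ[X]) :
    (circlePoly m n P).natDegree ≤ 2 * m * n := by
  refine natDegree_sum_le_of_forall_le _ _ fun k hk => ?_
  obtain ⟨l, rfl⟩ := Nat.exists_eq_add_of_le (Nat.lt_succ_iff.1 (Finset.mem_range.1 hk))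
  have h1 : (C (P.coeff k : ℂ) * X ^ (m * (k + l - k)) : ℂ[X]).natDegree ≤ m * (k + l - k) :=
    natDegree_C_mul_X_pow_le _ _
  have h2 : (C (1 / 2 : ℂ) * (X ^ (2 * m) + 1) : ℂ[X]).natDegree ≤ 2 * m :=
    (natDegree_C_mul_le _ _).trans (natDegree_add_le_of_degree_le (natDegree_X_pow_le _) (by simp))
  calc _ ≤ m * (k + l - k) + k * (2 * m) :=
        natDegree_mul_le.trans (Nat.add_le_add h1 (natDegree_pow_le_of_le k h2))
    _ ≤ 2 * m * (k + l) := by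
        rw [Nat.add_sub_cancel_left]
        nlinarith

theorem circlePoly_eval_circPt (m : ℕ) {n : ℕ} {P : ℝ[X]} (hP : P.natDegree ≤ n) (t : ℝ) :
    (circlePoly m n P).eval (circPt t) =
      circPt ((2 * m * n : ℕ) * t / 2) * (P.eval (Real.cos (m * t)) : ℝ) := by
  have angle : (m * n : ℕ) * t = (2 * m * n : ℕ) * t / 2 := by push_cast; ring
  rw [circlePoly_eval m n P hP _ (circPt_ne_zero t), circPt_pow, circPt_pow, circPt_div_two_add,
    angle]
  exact congrArg _ (aeval_algebraMap_apply ℂ (Real.cos (m * t)) P)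

theorem circlePoly_ne_zero (m : ℕ) {n : ℕ} {P : ℝ[X]} (hP : P.natDegree ≤ n)
    (hP₁ : P.eval 1 ≠ 0) : circlePoly m n P ≠ 0 := by
  intro h
  have h₀ := circlePoly_eval_circPt m hP 0
  rw [h, eval_zero, mul_zero (m : ℝ), Real.cos_zero] at h₀
  exact mul_ne_zero (circPt_ne_zero _) (Complex.ofReal_ne_zero.2 hP₁) h₀.symm

end CirclePoly

section ExtremalForces

variable {ι : Type*} [Fintype ι] {x : ι → ℝ}

theorem sum_cot_half_sub_of_pow_eq (hx : Function.Injective fun i => circPt (x i)) {s : ℝ}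
    (hroot : ∀ i, circPt (x i) ^ Fintype.card ι = circPt s) (t : ℝ) :
    ∑ i, Real.cot ((t - x i) / 2) = Fintype.card ι * Real.cot ((Fintype.card ι * t - s) / 2) := by
  rcases isEmpty_or_nonempty ι with _ | _
  · simp
  set N := Fintype.card ι with hN
  have hN0 : (N : ℝ) ≠ 0 := Nat.cast_ne_zero.2 Fintype.card_ne_zero
  have d (t : ℝ) : HasDerivAt (fun t => (N * t - s) / 2) (N / 2) t := by
    simpa using (((hasDerivAt_id t).const_mul (N : ℝ)).sub_const s).div_const 2
  have d1 : deriv (fun t => Real.sin ((N * t - s) / 2)) =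
      fun t => Real.cos ((N * t - s) / 2) * (N / 2) := funext fun t => (d t).sin.deriv
  obtain ⟨c, hc, hf⟩ := exists_eq_mul_prod_sin (f := fun t => Real.sin ((N * t - s) / 2))
    (R := C (circPt (s / 2) * (2 * Complex.I))⁻¹ * (X ^ N - C (circPt s))) hx
    ((natDegree_C_mul_le _ _).trans_eq natDegree_X_pow_sub_C) (fun i => by simp [hroot])
    (fun t => by
      have hs := circPt_ne_zero (s / 2)
      rw [eval_C_mul, eval_sub, eval_pow, eval_X, eval_C, circPt_pow, circPt_sub_circPt, add_div,
        circPt_add, hN]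
      field_simp)
    (t₀ := (s + Real.pi) / N) (by field_simp; simp)
  by_cases ht : Real.sin ((N * t - s) / 2) = 0
  · rw [(sum_cot_half_sub_of_eq_zero hx hc hf ht).2, d1, ((d t).cos.mul_const _).deriv,
      Real.cot_eq_cos_div_sin, ht]
    simp
  · rw [sum_cot_half_sub_of_ne_zero hf ht, logDeriv_apply, d1, Real.cot_eq_cos_div_sin]
    ring

theorem hasDerivAt_eval_cos (P : ℝ[X]) (m : ℕ) (t : ℝ) :
    HasDerivAt (fun t => P.eval (Real.cos (m * t)))
      (-(m * Real.sin (m * t) * P.derivative.eval (Real.cos (m * t)))) t := by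
  have h := (P.hasDerivAt (Real.cos (m * t))).comp t (((hasDerivAt_id t).const_mul (m : ℝ)).cos)
  refine h.congr_deriv ?_
  simp only [id, mul_one]
  ring

theorem deriv_eval_cos (P : ℝ[X]) (m : ℕ) :
    deriv (fun t => P.eval (Real.cos (m * t))) =
      fun t => -(m * Real.sin (m * t) * P.derivative.eval (Real.cos (m * t))) :=
  funext fun t => (hasDerivAt_eval_cos P m t).deriv

theorem deriv_deriv_eval_cos (P : ℝ[X]) (m : ℕ) (t : ℝ) :
    deriv (deriv fun t => P.eval (Real.cos (m * t))) t =
      m ^ 2 * ((1 - Real.cos (m * t) ^ 2) * P.derivative.derivative.eval (Real.cos (m * t)) -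
        Real.cos (m * t) * P.derivative.eval (Real.cos (m * t))) := by
  have d := ((hasDerivAt_id t).const_mul (m : ℝ)).sin.const_mul (m : ℝ)
  rw [deriv_eval_cos, ← Real.sin_sq]
  refine (d.mul (hasDerivAt_eval_cos P.derivative m t)).neg.deriv.trans ?_
  simp only [id, mul_one]
  ring

section ZerosOnCircle

variable {m n : ℕ} {P : ℝ[X]} (hcard : Fintype.card ι = 2 * m * n) (hP : P.natDegree ≤ n)
  (hP₁ : P.eval 1 ≠ 0) (hx : Function.Injective fun i => circPt (x i))
  (hroot : ∀ i, (circlePoly m n P).eval (circPt (x i)) = 0)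

include hcard hP hP₁ hx hroot

theorem exists_eval_cos_eq_mul_prod_sin :
    ∃ c ≠ 0, (fun t => P.eval (Real.cos (m * t))) = fun t => c * ∏ i, Real.sin ((t - x i) / 2) :=
  exists_eq_mul_prod_sin hx ((circlePoly_natDegree_le m n P).trans_eq hcard.symm) hroot
    (fun t => by rw [hcard, circlePoly_eval_circPt m hP]) (t₀ := 0) (by simpa using hP₁)

theorem sum_cot_half_sub_of_sin_eq_zero {t : ℝ} (ht : Real.sin (m * t) = 0) :
    ∑ i, Real.cot ((t - x i) / 2) = 0 := by
  obtain ⟨c, hc, hf⟩ := exists_eval_cos_eq_mul_prod_sin hcard hP hP₁ hx hroot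
  have critical : deriv (fun t => P.eval (Real.cos (m * t))) t = 0 := by
    simp only [deriv_eval_cos, ht, mul_zero, zero_mul, neg_zero]
  have nonzero : P.eval (Real.cos (m * t)) ≠ 0 := fun h =>
    (sum_cot_half_sub_of_eq_zero hx hc hf h).1 critical
  rw [sum_cot_half_sub_of_ne_zero hf nonzero, logDeriv_apply, critical, zero_div, mul_zero]

theorem sum_cot_half_sub_of_eval_cos_eq_zero {t : ℝ} (ht : P.eval (Real.cos (m * t)) = 0) :
    m * Real.sin (m * t) * P.derivative.eval (Real.cos (m * t)) ≠ 0 ∧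
      ∑ i, Real.cot ((t - x i) / 2) =
        -(m ^ 2 * ((1 - Real.cos (m * t) ^ 2) * P.derivative.derivative.eval (Real.cos (m * t)) -
          Real.cos (m * t) * P.derivative.eval (Real.cos (m * t))) /
            (m * Real.sin (m * t) * P.derivative.eval (Real.cos (m * t)))) := by
  obtain ⟨c, hc, hf⟩ := exists_eval_cos_eq_mul_prod_sin hcard hP hP₁ hx hroot
  have h := sum_cot_half_sub_of_eq_zero hx hc hf ht
  rwa [deriv_deriv_eval_cos, deriv_eval_cos, neg_ne_zero, div_neg] at h

end ZerosOnCircle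

theorem sin_mul_cot_half {s : ℝ} (hs : Real.sin s ≠ 0) :
    Real.sin s * Real.cot (s / 2) = 1 + Real.cos s := by
  obtain ⟨u, rfl⟩ : ∃ u, s = 2 * u := ⟨s / 2, by ring⟩
  rw [Real.sin_two_mul] at hs ⊢
  have hu : Real.sin u ≠ 0 := fun h => hs (by rw [h]; ring)
  rw [mul_div_cancel_left₀ u two_ne_zero, Real.cot_eq_cos_div_sin, Real.cos_two_mul]
  field_simp
  ring

theorem sin_mul_cot_half_sub_pi {s : ℝ} (hs : Real.sin s ≠ 0) :
    Real.sin s * Real.cot ((s - Real.pi) / 2) = Real.cos s - 1 := by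
  have h := sin_mul_cot_half (s := s - Real.pi) (by rwa [Real.sin_sub_pi, neg_ne_zero])
  rw [Real.sin_sub_pi, Real.cos_sub_pi] at h
  linarith

theorem sum_cot_half_sub_jacobi {m n : ℕ} {p q : ℝ} (hp : 0 < p)
    (hcard : Fintype.card ι = 2 * m * n) (hx : Function.Injective fun i => circPt (x i))
    (hroot : ∀ i, (circlePoly m n (jacobiPoly n (p - 1 / 2) (q - 1 / 2))).eval (circPt (x i)) = 0)
    (a : ι) :
    ∑ i, Real.cot ((x a - x i) / 2) =
      -(m * (p * Real.cot (m * x a / 2) + q * Real.cot ((m * x a - Real.pi) / 2))) := by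
  set P := jacobiPoly n (p - 1 / 2) (q - 1 / 2) with hP
  have hdeg : P.natDegree ≤ n := jacobiPoly_natDegree_le _ _ _
  have zero : P.eval (Real.cos (m * x a)) = 0 := by
    have h := hroot a
    rw [circlePoly_eval_circPt m hdeg] at h
    exact Complex.ofReal_eq_zero.1 ((mul_eq_zero.1 h).resolve_left (circPt_ne_zero _))
  obtain ⟨hne, hsum⟩ := sum_cot_half_sub_of_eval_cos_eq_zero hcard hdeg
    (jacobiPoly_eval_one_pos n _ (by linarith)).ne' hx hroot zero
  have ode := congrArg (eval (Real.cos (m * x a))) (jacobiPoly_ode n (p - 1 / 2) (q - 1 / 2))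
  simp only [← hP, eval_add, eval_sub, eval_mul, eval_pow, eval_one, eval_X, eval_C, zero,
    eval_zero] at ode
  have hsin := right_ne_zero_of_mul (left_ne_zero_of_mul hne)
  have cot_p := sin_mul_cot_half hsin
  have cot_q := sin_mul_cot_half_sub_pi hsin
  rw [hsum, neg_inj, div_eq_iff hne]
  linear_combination (m : ℝ) ^ 2 * ode - (m : ℝ) ^ 2 * P.derivative.eval (Real.cos (m * x a)) *
    (p * cot_p + q * cot_q)

end ExtremalForces

section Energy

theorem cot_neg (u : ℝ) : Real.cot (-u) = -Real.cot u := by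
  rw [Real.cot_eq_cos_div_sin, Real.cot_eq_cos_div_sin, Real.cos_neg, Real.sin_neg, div_neg]

theorem log_sin_lt_of_mem_Ioo {u v : ℝ} (hu : u ∈ Set.Ioo 0 Real.pi) (hv : v ∈ Set.Ioo 0 Real.pi)
    (huv : u ≠ v) :
    Real.log (Real.sin v) < Real.log (Real.sin u) + Real.cot u * (v - u) := by
  have hsu := Real.sin_pos_of_mem_Ioo hu
  have hsv := Real.sin_pos_of_mem_Ioo hv
  have tangent : Real.sin v < Real.sin u + Real.cos u * (v - u) := by
    rcases huv.lt_or_gt with h | h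
    · have := strictConcaveOn_sin_Icc.slope_lt_of_hasDerivAt (Set.Ioo_subset_Icc_self hu)
        (Set.Ioo_subset_Icc_self hv) h (Real.hasDerivAt_sin u)
      rw [slope_def_field, div_lt_iff₀ (sub_pos.2 h)] at this
      linarith
    · have := strictConcaveOn_sin_Icc.lt_slope_of_hasDerivAt (Set.Ioo_subset_Icc_self hv)
        (Set.Ioo_subset_Icc_self hu) h (Real.hasDerivAt_sin u)
      rw [slope_def_field, lt_div_iff₀ (sub_pos.2 h)] at this
      linarith
  have ratio : Real.sin v / Real.sin u < 1 + Real.cot u * (v - u) := by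
    rw [div_lt_iff₀ hsu, Real.cot_eq_cos_div_sin]
    field_simp
    exact tangent
  have log_ratio := Real.log_le_sub_one_of_pos (div_pos hsv hsu)
  rw [Real.log_div hsv.ne' hsu.ne'] at log_ratio
  linarith

theorem log_sin_lt {u v : ℝ} (hu : |u| < Real.pi) (hv : |v| < Real.pi) (h : 0 < u * v)
    (huv : u ≠ v) :
    Real.log (Real.sin v) < Real.log (Real.sin u) + Real.cot u * (v - u) := by
  rw [abs_lt] at hu hv
  rcases mul_pos_iff.1 h with ⟨h₁, h₂⟩ | ⟨h₁, h₂⟩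
  · exact log_sin_lt_of_mem_Ioo ⟨h₁, hu.2⟩ ⟨h₂, hv.2⟩ huv
  · have key := log_sin_lt_of_mem_Ioo (u := -u) (v := -v) ⟨by linarith, by linarith⟩
      ⟨by linarith, by linarith⟩ (neg_injective.ne huv)
    rw [Real.sin_neg, Real.sin_neg, Real.log_neg_eq_log, Real.log_neg_eq_log, cot_neg] at key
    linarith

theorem log_norm_circPt_sub_lt {s t s' t' : ℝ} (h : |(s - t) / 2| < Real.pi)
    (h' : |(s' - t') / 2| < Real.pi) (hpos : 0 < (s - t) * (s' - t')) (hne : s - t ≠ s' - t') :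
    Real.log ‖circPt s' - circPt t'‖ < Real.log ‖circPt s - circPt t‖ +
      Real.cot ((s - t) / 2) * ((s' - s) / 2 - (t' - t) / 2) := by
  have sin_ne {u : ℝ} (hu : |u| < Real.pi) (hu0 : u ≠ 0) : |Real.sin u| ≠ 0 :=
    abs_ne_zero.2 fun e =>
      hu0 ((Real.sin_eq_zero_iff_of_lt_of_lt (abs_lt.1 hu).1 (abs_lt.1 hu).2).1 e)
  have key := log_sin_lt h h' (by linarith) fun e => hne (by linarith)
  rw [norm_circPt_sub, norm_circPt_sub,
    Real.log_mul two_ne_zero (sin_ne h' (div_ne_zero (right_ne_zero_of_mul hpos.ne') two_ne_zero)),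
    Real.log_mul two_ne_zero (sin_ne h (div_ne_zero (left_ne_zero_of_mul hpos.ne') two_ne_zero)),
    Real.log_abs, Real.log_abs]
  linarith

variable {ι : Type*} [Fintype ι]

/-- Twice the logarithmic energy of charges `w a` at the points `e^{i x a}`; the diagonal terms
vanish because `Real.log 0 = 0`. -/
noncomputable def logEnergy (w x : ι → ℝ) : ℝ :=
  ∑ a, ∑ b, w a * w b * Real.log ‖circPt (x a) - circPt (x b)‖

/-- Charges `w a` at the points `e^{i x a}` exert no tangential force on one another; the term
`b = a` vanishes because `Real.cot 0 = 0`. -/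
def IsEquilibrium (w x : ι → ℝ) : Prop :=
  ∀ a, ∑ b, w b * Real.cot ((x a - x b) / 2) = 0

theorem IsEquilibrium.virtual_work_eq_zero {w x : ι → ℝ} (h : IsEquilibrium w x) (v : ι → ℝ) :
    ∑ a, ∑ b, w a * w b * (Real.cot ((x a - x b) / 2) * (v a - v b)) = 0 := by
  have cot_swap (a b : ι) : Real.cot ((x a - x b) / 2) = -Real.cot ((x b - x a) / 2) := by
    rw [← cot_neg, ← neg_div, neg_sub]
  have work_single (a b : ι) : w a * w b * (Real.cot ((x a - x b) / 2) * (v a - v b)) =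
      w a * v a * (w b * Real.cot ((x a - x b) / 2)) +
        w b * v b * (w a * Real.cot ((x b - x a) / 2)) := by
    rw [cot_swap b a]
    ring
  simp only [work_single, Finset.sum_add_distrib]
  rw [Finset.sum_comm (f := fun a b => w b * v b * (w a * Real.cot ((x b - x a) / 2)))]
  simp only [← Finset.mul_sum, h _, mul_zero, Finset.sum_const_zero, add_zero]

theorem IsEquilibrium.logEnergy_lt {w x y : ι → ℝ} (h : IsEquilibrium w x) (hw : ∀ a, 0 < w a)
    (hx : ∀ a, x a ∈ Set.Ico 0 (2 * Real.pi)) (hy : ∀ a, y a ∈ Set.Ico 0 (2 * Real.pi))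
    (hinj : Function.Injective x) (hxy : ∀ a b, x a < x b → y a < y b) {a₀ : ι}
    (h₀ : x a₀ = y a₀) (hne : x ≠ y) : logEnergy w y < logEnergy w x := by
  set v : ι → ℝ := fun a => (y a - x a) / 2
  have pair_lt (a b : ι) (hab : x a - x b ≠ y a - y b) : Real.log ‖circPt (y a) - circPt (y b)‖ <
      Real.log ‖circPt (x a) - circPt (x b)‖ + Real.cot ((x a - x b) / 2) * (v a - v b) := by
    refine log_norm_circPt_sub_lt (abs_half_sub_lt_pi (hx a) (hx b))
      (abs_half_sub_lt_pi (hy a) (hy b)) ?_ hab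
    have hne : x a ≠ x b := fun e => hab (by rw [hinj e, sub_self, sub_self])
    rcases hne.lt_or_gt with hlt | hlt
    · exact mul_pos_of_neg_of_neg (sub_neg.2 hlt) (sub_neg.2 (hxy a b hlt))
    · exact mul_pos (sub_pos.2 hlt) (sub_pos.2 (hxy b a hlt))
  have pair_le (a b : ι) : Real.log ‖circPt (y a) - circPt (y b)‖ ≤
      Real.log ‖circPt (x a) - circPt (x b)‖ + Real.cot ((x a - x b) / 2) * (v a - v b) := by
    by_cases hab : x a - x b = y a - y b
    · have hv : v a - v b = 0 := by simp only [v]; linarith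
      rw [norm_circPt_sub, norm_circPt_sub, hab, hv, mul_zero, add_zero]
    · exact (pair_lt a b hab).le
  have hww (a b : ι) : 0 < w a * w b := mul_pos (hw a) (hw b)
  have scaled_le (a b : ι) := mul_le_mul_of_nonneg_left (pair_le a b) (hww a b).le
  obtain ⟨c, hc⟩ := Function.ne_iff.1 hne
  calc logEnergy w y
      < ∑ a, ∑ b, w a * w b * (Real.log ‖circPt (x a) - circPt (x b)‖ +
          Real.cot ((x a - x b) / 2) * (v a - v b)) :=
        Finset.sum_lt_sum (fun a _ => Finset.sum_le_sum fun b _ => scaled_le a b)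
          ⟨c, Finset.mem_univ c, Finset.sum_lt_sum (fun b _ => scaled_le c b)
            ⟨a₀, Finset.mem_univ a₀, mul_lt_mul_of_pos_left
              (pair_lt c a₀ fun e => hc (by linarith)) (hww c a₀)⟩⟩
    _ = logEnergy w x := by
        simp only [mul_add, Finset.sum_add_distrib, h.virtual_work_eq_zero, add_zero, logEnergy]

end Energy

section Angles

variable {m n : ℕ}

/-- The charges of a configuration as one family. -/
def charge (m n : ℕ) (p q : ℝ) : Fin m ⊕ Fin m ⊕ Fin (2 * m * n) → ℝ :=
  Sum.elim (fun _ => p) (Sum.elim (fun _ => q) fun _ => 1)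

/-- The angles of a configuration as one family. -/
def angles (x : Config m n) : Fin m ⊕ Fin m ⊕ Fin (2 * m * n) → ℝ :=
  Sum.elim x.1 (Sum.elim x.2.1 x.2.2)

theorem angles_injective : Function.Injective (angles (m := m) (n := n)) := by
  rintro ⟨φ, ψ, θ⟩ ⟨φ', ψ', θ'⟩ h
  simpa [angles, Sum.elim_eq_iff] using h

theorem two_mul_sum_sum_Iio {ι : Type*} [Fintype ι] [LinearOrder ι] [LocallyFiniteOrderBot ι]
    [LocallyFiniteOrderTop ι] {f : ι → ι → ℝ} (hdiag : ∀ j, f j j = 0)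
    (hsymm : ∀ j k, f j k = f k j) :
    2 * ∑ j, ∑ k ∈ Finset.Iio j, f j k = ∑ j, ∑ k, f j k := by
  have above : ∑ j, ∑ k ∈ Finset.Iio j, f j k = ∑ j, ∑ k ∈ Finset.Ioi j, f j k := by
    rw [Finset.sum_comm' (t' := Finset.univ) (s' := Finset.Ioi) (by simp)]
    exact Finset.sum_congr rfl fun j _ => Finset.sum_congr rfl fun k _ => hsymm _ _
  have off_diag (j : ι) : ∑ k ∈ {j}ᶜ, f k j = ∑ k, f j k := by
    rw [Fintype.sum_eq_add_sum_compl j, hdiag, zero_add]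
    exact Finset.sum_congr rfl fun k _ => hsymm k j
  rw [two_mul, above, ← Finset.sum_add_distrib]
  simp only [← Finset.sum_add_distrib, ← off_diag, ← Finset.sum_sum_Ioi_add_eq_sum_sum_off_diag]
  exact Finset.sum_congr rfl fun j _ => Finset.sum_congr rfl fun k _ => by rw [hsymm k j]

theorem two_mul_hamiltonian (p q : ℝ) (x : Config m n) :
    2 * hamiltonian m n p q x = logEnergy (charge m n p q) (angles x) := by
  have pairs {N : ℕ} (t : Fin N → ℝ) :=
    two_mul_sum_sum_Iio (f := fun j k => Real.log ‖circPt (t j) - circPt (t k)‖)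
      (fun j => by simp) (fun j k => by rw [norm_sub_rev])
  have swap {M N : ℕ} (s : Fin M → ℝ) (t : Fin N → ℝ) :
      ∑ j, ∑ k, Real.log ‖circPt (t j) - circPt (s k)‖ =
        ∑ j, ∑ k, Real.log ‖circPt (s j) - circPt (t k)‖ := by
    rw [Finset.sum_comm]
    simp only [norm_sub_rev]
  simp only [logEnergy, charge, angles, Fintype.sum_sum_type, Sum.elim_inl, Sum.elim_inr,
    Finset.sum_add_distrib, ← Finset.mul_sum, one_mul, mul_one]
  rw [swap x.1 x.2.1, swap x.1 x.2.2, swap x.2.1 x.2.2, ← pairs x.1, ← pairs x.2.1,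
    ← pairs x.2.2, hamiltonian]
  ring

end Angles

section ConfigSpace

variable {m n : ℕ}

theorem nextAngle_combo (φ φ' : Fin m → ℝ) (j : Fin m) {a b : ℝ} (hab : a + b = 1) :
    nextAngle (a • φ + b • φ') j = a * nextAngle φ j + b * nextAngle φ' j := by
  unfold nextAngle
  split_ifs
  · simp
  · rw [← add_mul, hab, one_mul]

theorem convex_combo_lt {a b s t s' t' : ℝ} (ha : 0 ≤ a) (hb : 0 ≤ b) (hab : a + b = 1)
    (h : s < t) (h' : s' < t') : a * s + b * s' < a * t + b * t' := by
  have pos : 0 < a * (t - s) + b * (t' - s') :=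
    convex_Ioi (0 : ℝ) (sub_pos.2 h) (sub_pos.2 h') ha hb hab
  linarith

theorem convex_configSpace (m n : ℕ) : Convex ℝ (configSpace m n) := by
  rintro x ⟨hx_zero, hx_mono, hx_left, hx_right⟩ y ⟨hy_zero, hy_mono, hy_left, hy_right⟩
    a b ha hb hab
  have lt {s t s' t' : ℝ} (h : s < t) (h' : s' < t') := convex_combo_lt ha hb hab h h'
  refine ⟨fun j hj => by simp [hx_zero j hj, hy_zero j hj],
    fun k l hkl => lt (hx_mono hkl) (hy_mono hkl), fun j k h₁ h₂ => ?_, fun j k h₁ h₂ => ?_⟩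
  · have hx := hx_left j k h₁ h₂
    have hy := hy_left j k h₁ h₂
    exact ⟨lt hx.1 hy.1, lt hx.2 hy.2⟩
  · have hx := hx_right j k h₁ h₂
    have hy := hy_right j k h₁ h₂
    exact ⟨lt hx.1 hy.1, (lt hx.2 hy.2).trans_eq (nextAngle_combo _ _ _ hab).symm⟩

/-- The alternating sequence `φ 0, ψ 0, φ 1, ψ 1, …` of a configuration, continued by the constant
`2π`; the `θ`'s come in blocks of `n` between consecutive terms. -/
noncomputable def wall (x : Config m n) (i : ℕ) : ℝ :=
  if h : i / 2 < m then if i % 2 = 0 then x.1 ⟨i / 2, h⟩ else x.2.1 ⟨i / 2, h⟩ else 2 * Real.pi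

theorem wall_two_mul (x : Config m n) (j : Fin m) : wall x (2 * j) = x.1 j := by
  simp [wall]

theorem wall_two_mul_add_one (x : Config m n) (j : Fin m) : wall x (2 * j + 1) = x.2.1 j := by
  have hdiv : (2 * (j : ℕ) + 1) / 2 = j := by omega
  simp [wall, hdiv]

theorem wall_eq_two_pi (x : Config m n) : wall x (2 * m) = 2 * Real.pi := by
  simp [wall]

theorem nextAngle_eq_wall (x : Config m n) (j : Fin m) :
    nextAngle x.1 j = wall x (2 * j + 1 + 1) := by
  have hdiv : (2 * (j : ℕ) + 1 + 1) / 2 = j + 1 := by omega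
  have hmod : (2 * (j : ℕ) + 1 + 1) % 2 = 0 := by omega
  simp [nextAngle, wall, hdiv, hmod]

theorem mem_configSpace_iff (hm : 1 ≤ m) (hn : 1 ≤ n) {x : Config m n} :
    x ∈ configSpace m n ↔ wall x 0 = 0 ∧ StrictMono x.2.2 ∧
      ∀ k : Fin (2 * m * n), wall x (k / n) < x.2.2 k ∧ x.2.2 k < wall x (k / n + 1) := by
  have div_eq {i k : ℕ} : k / n = i ↔ i * n ≤ k ∧ k < (i + 1) * n := by
    rw [Nat.div_eq_iff hn, add_mul]
    omega
  have wall_zero : wall x 0 = x.1 ⟨0, hm⟩ := wall_two_mul x ⟨0, hm⟩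
  constructor
  · rintro ⟨zero, mono, left, right⟩
    refine ⟨wall_zero.trans (zero _ rfl), mono, fun k => ?_⟩
    have hk : (k : ℕ) / n < 2 * m := Nat.div_lt_of_lt_mul (by linarith [k.2, mul_comm n (2 * m)])
    rcases Nat.even_or_odd' (k / n) with ⟨j, hj | hj⟩
    · have h := left ⟨j, by omega⟩ k (div_eq.1 hj).1 (div_eq.1 hj).2
      rwa [← wall_two_mul, ← wall_two_mul_add_one, ← hj] at h
    · have h := right ⟨j, by omega⟩ k (div_eq.1 hj).1 (div_eq.1 hj).2
      rwa [← wall_two_mul_add_one, nextAngle_eq_wall, ← hj] at h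
  · rintro ⟨zero, mono, between⟩
    refine ⟨fun j hj => ?_, mono, fun j k h₁ h₂ => ?_, fun j k h₁ h₂ => ?_⟩
    · rw [← zero, wall_zero]
      exact congrArg x.1 (Fin.ext hj)
    · have h := between k
      rwa [div_eq.2 ⟨h₁, h₂⟩, wall_two_mul, wall_two_mul_add_one] at h
    · have h := between k
      rwa [div_eq.2 ⟨h₁, h₂⟩, wall_two_mul_add_one, ← nextAngle_eq_wall] at h

/-- The place of a particle in the cyclic order around the circle: the `i`-th wall is `(i, 0)`, and
the `θ`'s between the `i`-th wall and the next one are `(i, k + 1)`. -/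
def slot : Fin m ⊕ Fin m ⊕ Fin (2 * m * n) → ℕ ×ₗ ℕ :=
  Sum.elim (fun j => toLex (2 * (j : ℕ), 0)) (Sum.elim (fun j => toLex (2 * (j : ℕ) + 1, 0))
    fun k => toLex ((k : ℕ) / n, (k : ℕ) + 1))

theorem slot_injective : Function.Injective (slot (m := m) (n := n)) := by
  rintro (i | i | k) (j | j | l) h <;>
    simp only [slot, Sum.elim_inl, Sum.elim_inr, toLex_inj, Prod.mk.injEq] at h <;>
    first | omega | (congr; omega)

section Order

variable (hm : 1 ≤ m) (hn : 1 ≤ n) {x : Config m n} (hx : x ∈ configSpace m n)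

include hm hn hx

theorem wall_lt_theta {i : ℕ} {k : Fin (2 * m * n)} (hik : i ≤ k / n) : wall x i < x.2.2 k := by
  obtain ⟨-, mono, between⟩ := (mem_configSpace_iff hm hn).1 hx
  have first_le : i * n ≤ k := (Nat.le_div_iff_mul_le hn).1 hik
  have h := (between ⟨i * n, first_le.trans_lt k.2⟩).1
  rw [Nat.mul_div_cancel i hn] at h
  exact h.trans_le (mono.monotone first_le)

theorem theta_lt_wall {i : ℕ} {k : Fin (2 * m * n)} (hki : k / n < i) (hi : i ≤ 2 * m) :
    x.2.2 k < wall x i := by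
  obtain ⟨-, mono, between⟩ := (mem_configSpace_iff hm hn).1 hx
  obtain ⟨i, rfl⟩ : ∃ l, i = l + 1 := Nat.exists_eq_add_one.2 (Nat.zero_lt_of_lt hki)
  have last_lt : (i + 1) * n - 1 < 2 * m * n := by
    have le := Nat.mul_le_mul_right n hi
    have pos : 0 < (i + 1) * n := Nat.mul_pos i.succ_pos hn
    omega
  have last_div : ((i + 1) * n - 1) / n = i := by
    refine (Nat.div_eq_iff hn).2 ?_
    rw [add_mul]
    omega
  have h := (between ⟨(i + 1) * n - 1, last_lt⟩).2
  rw [last_div] at h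
  have k_lt := (Nat.div_lt_iff_lt_mul hn).1 hki
  exact (mono.monotone (Fin.mk_le_mk.2 (Nat.le_sub_one_of_lt k_lt))).trans_lt h

theorem wall_lt_wall {i j : ℕ} (hij : i < j) (hj : j ≤ 2 * m) : wall x i < wall x j := by
  have hlt : i * n < 2 * m * n := Nat.mul_lt_mul_of_pos_right (hij.trans_le hj) hn
  have hdiv : i * n / n = i := Nat.mul_div_cancel i hn
  exact (wall_lt_theta hm hn hx (k := ⟨i * n, hlt⟩) hdiv.ge).trans
    (theta_lt_wall hm hn hx (hdiv.trans_lt hij) hj)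

theorem angles_lt_of_slot_lt {a b : Fin m ⊕ Fin m ⊕ Fin (2 * m * n)} (hab : slot a < slot b) :
    angles x a < angles x b := by
  have theta_mono := hx.2.1
  rcases a with i | i | k <;> rcases b with j | j | l <;>
    simp only [slot, Sum.elim_inl, Sum.elim_inr, Prod.Lex.toLex_lt_toLex] at hab <;>
    simp only [angles, Sum.elim_inl, Sum.elim_inr, ← wall_two_mul, ← wall_two_mul_add_one]
  all_goals first
    | exact wall_lt_wall hm hn hx (by omega) (by omega)
    | exact wall_lt_theta hm hn hx (by omega)
    | exact theta_lt_wall hm hn hx (by omega) (by omega)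
    | exact theta_mono (hab.elim Nat.lt_of_div_lt_div fun h => Nat.lt_of_succ_lt_succ h.2)

theorem angles_lt_angles_iff {a b : Fin m ⊕ Fin m ⊕ Fin (2 * m * n)} :
    angles x a < angles x b ↔ slot a < slot b := by
  refine ⟨fun h => lt_of_not_ge fun hle => ?_, angles_lt_of_slot_lt hm hn hx⟩
  rcases hle.eq_or_lt with he | hlt
  · exact h.ne (congrArg _ (slot_injective he).symm)
  · exact h.asymm (angles_lt_of_slot_lt hm hn hx hlt)

theorem injective_angles : Function.Injective (angles x) := by
  intro a b hab
  by_contra hne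
  rcases (slot_injective.ne hne).lt_or_gt with h | h
  · exact (angles_lt_of_slot_lt hm hn hx h).ne hab
  · exact (angles_lt_of_slot_lt hm hn hx h).ne' hab

theorem angles_mem_Ico (a : Fin m ⊕ Fin m ⊕ Fin (2 * m * n)) :
    angles x a ∈ Set.Ico 0 (2 * Real.pi) := by
  constructor
  · rw [← hx.1 ⟨0, hm⟩ rfl]
    refine le_of_not_gt fun h => ?_
    have slot_lt := (angles_lt_angles_iff hm hn hx (b := Sum.inl ⟨0, hm⟩)).1 h
    simp [slot, Prod.Lex.lt_iff] at slot_lt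
  · rw [← wall_eq_two_pi x]
    rcases a with j | j | k
    · exact (wall_two_mul x j).symm.trans_lt (wall_lt_wall hm hn hx (by omega) le_rfl)
    · exact (wall_two_mul_add_one x j).symm.trans_lt (wall_lt_wall hm hn hx (by omega) le_rfl)
    · exact theta_lt_wall hm hn hx
        (Nat.div_lt_of_lt_mul (k.2.trans_eq (mul_comm _ _))) le_rfl

theorem injective_circPt_angles : Function.Injective fun a => circPt (angles x a) :=
  fun _ _ h => injective_angles hm hn hx
    (injOn_circPt (angles_mem_Ico hm hn hx _) (angles_mem_Ico hm hn hx _) h)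

end Order

theorem hamiltonian_lt_of_isEquilibrium (hm : 1 ≤ m) (hn : 1 ≤ n) {p q : ℝ} (hp : 0 < p)
    (hq : 0 < q) {x y : Config m n} (hx : x ∈ configSpace m n) (hy : y ∈ configSpace m n)
    (hne : x ≠ y) (heq : IsEquilibrium (charge m n p q) (angles x)) :
    hamiltonian m n p q y < hamiltonian m n p q x := by
  have charge_pos (a) : 0 < charge m n p q a := by
    rcases a with _ | _ | _ <;> simp [charge, hp, hq]
  have first_eq : angles x (Sum.inl ⟨0, hm⟩) = angles y (Sum.inl ⟨0, hm⟩) :=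
    (hx.1 ⟨0, hm⟩ rfl).trans (hy.1 ⟨0, hm⟩ rfl).symm
  have key := heq.logEnergy_lt charge_pos (angles_mem_Ico hm hn hx) (angles_mem_Ico hm hn hy)
    (injective_angles hm hn hx)
    (fun a b h => (angles_lt_angles_iff hm hn hy).2 ((angles_lt_angles_iff hm hn hx).1 h))
    first_eq (angles_injective.ne hne)
  rw [← two_mul_hamiltonian, ← two_mul_hamiltonian] at key
  linarith

end ConfigSpace

section JacobiConfig

variable {m n : ℕ}

/-- The configurations the theorem describes: the `φ`'s and `ψ`'s are at the `m`-th roots of `1`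
and `-1`, and the `θ`'s at the zeros of `z^{mn} P_n^{(p-1/2, q-1/2)}((z^m + z^{-m})/2)`. -/
def IsJacobiConfig (p q : ℝ) (x : Config m n) : Prop :=
  Set.range (fun j => circPt (x.1 j)) = {z : ℂ | z ^ m = 1} ∧
  Set.range (fun j => circPt (x.2.1 j)) = {z : ℂ | z ^ m = -1} ∧
  Set.range (fun k => circPt (x.2.2 k)) =
    {z : ℂ | (circlePoly m n (jacobiPoly n (p - 1 / 2) (q - 1 / 2))).eval z = 0}

theorem cot_half_eq_zero {s : ℝ} (hs : Real.sin s = 0) : Real.cot (s / 2) = 0 := by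
  rw [← mul_div_cancel₀ s (two_ne_zero' ℝ), Real.sin_two_mul] at hs
  -- a division by zero when `s` is an even multiple of `π`
  rw [Real.cot_eq_cos_div_sin, div_eq_zero_iff]
  simpa [or_comm] using hs

namespace IsJacobiConfig

variable {p q : ℝ} {x : Config m n}

theorem sum_cot_half_sub_φ (h : IsJacobiConfig p q x)
    (inj : Function.Injective fun j => circPt (x.1 j)) (t : ℝ) :
    ∑ j, Real.cot ((t - x.1 j) / 2) = m * Real.cot (m * t / 2) := by
  have hroot (j) : circPt (x.1 j) ^ m = 1 := h.1.subset ⟨j, rfl⟩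
  simpa using sum_cot_half_sub_of_pow_eq inj (s := 0)
    (fun j => by simpa [circPt_zero] using hroot j) t

theorem sum_cot_half_sub_ψ (h : IsJacobiConfig p q x)
    (inj : Function.Injective fun j => circPt (x.2.1 j)) (t : ℝ) :
    ∑ j, Real.cot ((t - x.2.1 j) / 2) = m * Real.cot ((m * t - Real.pi) / 2) := by
  have hroot (j) : circPt (x.2.1 j) ^ m = -1 := h.2.1.subset ⟨j, rfl⟩
  simpa using sum_cot_half_sub_of_pow_eq inj (s := Real.pi)
    (fun j => by simpa [circPt_pi] using hroot j) t

theorem isEquilibrium (hm : 1 ≤ m) (hn : 1 ≤ n) (hp : 0 < p) (hx : x ∈ configSpace m n)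
    (h : IsJacobiConfig p q x) : IsEquilibrium (charge m n p q) (angles x) := by
  have inj := injective_circPt_angles hm hn hx
  have force_φ := h.sum_cot_half_sub_φ (inj.comp Sum.inl_injective)
  have force_ψ := h.sum_cot_half_sub_ψ (inj.comp (Sum.inr_injective.comp Sum.inl_injective))
  have inj_θ : Function.Injective fun k => circPt (x.2.2 k) :=
    inj.comp (Sum.inr_injective.comp Sum.inr_injective)
  have φ_root (j) : circPt (x.1 j) ^ m = 1 := h.1.subset ⟨j, rfl⟩
  have ψ_root (j) : circPt (x.2.1 j) ^ m = -1 := h.2.1.subset ⟨j, rfl⟩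
  have θ_root (k) := h.2.2.subset ⟨k, rfl⟩
  have force_zero {t : ℝ} (ht : Real.sin (m * t) = 0) : p * ∑ j, Real.cot ((t - x.1 j) / 2) +
      (q * ∑ j, Real.cot ((t - x.2.1 j) / 2) + ∑ k, Real.cot ((t - x.2.2 k) / 2)) = 0 := by
    have ht_pi : Real.sin (m * t - Real.pi) = 0 := by rw [Real.sin_sub_pi, ht, neg_zero]
    rw [force_φ, force_ψ, cot_half_eq_zero ht, cot_half_eq_zero ht_pi,
      sum_cot_half_sub_of_sin_eq_zero (Fintype.card_fin _) (jacobiPoly_natDegree_le _ _ _)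
        (jacobiPoly_eval_one_pos n _ (by linarith)).ne' inj_θ θ_root ht]
    ring
  intro a
  simp only [charge, angles, Fintype.sum_sum_type, Sum.elim_inl, Sum.elim_inr, ← Finset.mul_sum,
    one_mul]
  rcases a with j | j | k
  · exact force_zero (t := x.1 j) (by rw [← circPt_im, ← circPt_pow, φ_root, Complex.one_im])
  · exact force_zero (t := x.2.1 j)
      (by rw [← circPt_im, ← circPt_pow, ψ_root, Complex.neg_im, Complex.one_im, neg_zero])
  · simp only [Sum.elim_inr, force_φ, force_ψ,
      sum_cot_half_sub_jacobi hp (Fintype.card_fin _) inj_θ θ_root k]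
    ring

end IsJacobiConfig

/-- The angle in `(iπ, (i+1)π)` with the same cosine as `τ r` or, for odd `i`, as `τ r.rev`, so that
it increases with `r` when `τ` does. -/
noncomputable def unfoldedAngle (τ : Fin n → ℝ) (i : ℕ) (r : Fin n) : ℝ :=
  (if Even i then τ r else Real.pi - τ r.rev) + i * Real.pi

theorem unfoldedAngle_mem_Ioo {τ : Fin n → ℝ} (hτ : ∀ r, τ r ∈ Set.Ioo 0 Real.pi) (i : ℕ)
    (r : Fin n) : unfoldedAngle τ i r ∈ Set.Ioo (i * Real.pi) ((i + 1) * Real.pi) := by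
  have h := hτ r
  have h_rev := hτ r.rev
  unfold unfoldedAngle
  split_ifs <;> constructor <;> linarith [h.1, h.2, h_rev.1, h_rev.2]

theorem strictMono_unfoldedAngle {τ : Fin n → ℝ} (hτ : StrictMono τ) (i : ℕ) :
    StrictMono (unfoldedAngle τ i) := by
  intro r s hrs
  have h := hτ hrs
  have h_rev := hτ (Fin.rev_lt_rev.2 hrs)
  unfold unfoldedAngle
  split_ifs <;> linarith

theorem cos_unfoldedAngle (τ : Fin n → ℝ) (i : ℕ) (r : Fin n) :
    Real.cos (unfoldedAngle τ i r) = Real.cos (τ (if Even i then r else r.rev)) := by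
  unfold unfoldedAngle
  rw [Real.cos_add_nat_mul_pi]
  split_ifs with h
  · rw [h.neg_one_pow, one_mul]
  · rw [(Nat.not_even_iff_odd.1 h).neg_one_pow, Real.cos_pi_sub, neg_one_mul, neg_neg]

/-- The configuration with equally spaced walls and, in each gap between them, a copy of the angles
`τ` (scaled by `1 / m`), reflected in every other gap. -/
noncomputable def unfoldedConfig (m : ℕ) (τ : Fin n → ℝ) : Config m n :=
  (fun j => (2 * j : ℕ) * Real.pi / m, fun j => (2 * j + 1 : ℕ) * Real.pi / m,
    fun k => unfoldedAngle τ k.divNat k.modNat / m)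

theorem wall_unfoldedConfig (hm : 1 ≤ m) (τ : Fin n → ℝ) {i : ℕ} (hi : i ≤ 2 * m) :
    wall (unfoldedConfig m τ) i = i * Real.pi / m := by
  rcases hi.eq_or_lt with rfl | hi
  · rw [wall_eq_two_pi, Nat.cast_mul, Nat.cast_ofNat]
    field_simp
  · rcases Nat.even_or_odd' i with ⟨j, rfl | rfl⟩
    · exact wall_two_mul _ ⟨j, by omega⟩
    · exact wall_two_mul_add_one _ ⟨j, by omega⟩

theorem unfoldedConfig_mem_configSpace (hm : 1 ≤ m) (hn : 1 ≤ n) {τ : Fin n → ℝ}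
    (hτ_mono : StrictMono τ) (hτ : ∀ r, τ r ∈ Set.Ioo 0 Real.pi) :
    unfoldedConfig m τ ∈ configSpace m n := by
  have hm₀ : (0 : ℝ) < m := Nat.cast_pos.2 hm
  refine (mem_configSpace_iff hm hn).2 ⟨?_, fun k l hkl => ?_, fun k => ?_⟩
  · simp [wall_unfoldedConfig hm τ (Nat.zero_le _)]
  · refine div_lt_div_of_pos_right ?_ hm₀
    rcases (Nat.div_le_div_right (c := n) hkl.le).eq_or_lt with hdiv | hdiv
    · have hmod : k.modNat < l.modNat := by
        rw [Fin.lt_def, Fin.coe_modNat, Fin.coe_modNat]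
        have hk := Nat.div_add_mod (k : ℕ) n
        have hl := Nat.div_add_mod (l : ℕ) n
        rw [← hdiv] at hl
        omega
      simpa only [Fin.coe_divNat, hdiv] using strictMono_unfoldedAngle hτ_mono _ hmod
    · calc unfoldedAngle τ k.divNat k.modNat < ((k / n : ℕ) + 1) * Real.pi :=
            (unfoldedAngle_mem_Ioo hτ _ _).2
        _ ≤ (l / n : ℕ) * Real.pi := by
            gcongr
            exact_mod_cast hdiv
        _ < unfoldedAngle τ l.divNat l.modNat := (unfoldedAngle_mem_Ioo hτ _ _).1
  · have hk : (k : ℕ) / n < 2 * m := k.divNat.2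
    obtain ⟨lower, upper⟩ := unfoldedAngle_mem_Ioo hτ k.divNat k.modNat
    rw [wall_unfoldedConfig hm τ hk.le, wall_unfoldedConfig hm τ hk, Nat.cast_succ]
    exact ⟨div_lt_div_of_pos_right lower hm₀, div_lt_div_of_pos_right upper hm₀⟩

theorem range_circPt_eq_setOf_pow_eq {t : Fin m → ℝ} (ht : Function.Injective fun j => circPt (t j))
    (hm : 1 ≤ m) {c : ℂ} (hroot : ∀ j, circPt (t j) ^ m = c) :
    Set.range (fun j => circPt (t j)) = {z : ℂ | z ^ m = c} := by
  rw [range_eq_setOf_eval_eq_zero (R := X ^ m - C c) ht (X_pow_sub_C_ne_zero hm c)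
    (natDegree_X_pow_sub_C.trans (Fintype.card_fin m).symm).le (fun j => by simp [hroot])]
  simp [sub_eq_zero]

theorem isJacobiConfig_unfoldedConfig (hm : 1 ≤ m) (hn : 1 ≤ n) {p q : ℝ} (hp : 0 < p)
    {τ : Fin n → ℝ} (hτ_mono : StrictMono τ) (hτ : ∀ r, τ r ∈ Set.Ioo 0 Real.pi)
    (hroot : ∀ r, (jacobiPoly n (p - 1 / 2) (q - 1 / 2)).eval (Real.cos (τ r)) = 0) :
    IsJacobiConfig p q (unfoldedConfig m τ) := by
  have hm₀ : (m : ℝ) ≠ 0 := Nat.cast_ne_zero.2 (by omega)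
  have hdeg := jacobiPoly_natDegree_le n (p - 1 / 2) (q - 1 / 2)
  have inj := injective_circPt_angles hm hn (unfoldedConfig_mem_configSpace hm hn hτ_mono hτ)
  have pow_eq (i : ℕ) : circPt (i * Real.pi / m) ^ m = (-1) ^ i := by
    rw [circPt_pow, mul_div_cancel₀ _ hm₀, ← circPt_pow, circPt_pi]
  refine ⟨range_circPt_eq_setOf_pow_eq (inj.comp Sum.inl_injective) hm fun j => ?_,
    range_circPt_eq_setOf_pow_eq (inj.comp (Sum.inr_injective.comp Sum.inl_injective)) hm
      fun j => ?_,
    range_eq_setOf_eval_eq_zero (inj.comp (Sum.inr_injective.comp Sum.inr_injective))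
      (circlePoly_ne_zero m hdeg (jacobiPoly_eval_one_pos n _ (by linarith)).ne')
      ((circlePoly_natDegree_le _ _ _).trans_eq (Fintype.card_fin _).symm) fun k => ?_⟩
  · exact (pow_eq _).trans (even_two_mul _).neg_one_pow
  · exact (pow_eq _).trans (odd_two_mul_add_one _).neg_one_pow
  · change eval (circPt (unfoldedAngle τ k.divNat k.modNat / m)) _ = 0
    rw [circlePoly_eval_circPt m hdeg, mul_div_cancel₀ _ hm₀, cos_unfoldedAngle, hroot,
      Complex.ofReal_zero, mul_zero]

theorem exists_isJacobiConfig (hm : 1 ≤ m) (hn : 1 ≤ n) {p q : ℝ} (hp : 0 < p) (hq : 0 < q) :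
    ∃ x ∈ configSpace m n, IsJacobiConfig p q x := by
  obtain ⟨z, hz_mono, hz⟩ := exists_strictMono_jacobiPoly_roots n (α := p - 1 / 2)
    (β := q - 1 / 2) (by linarith) (by linarith)
  have hz_mem (i) : z i ∈ Set.Icc (-1) 1 := Set.Ioo_subset_Icc_self (hz i).1
  set τ : Fin n → ℝ := fun r => Real.arccos (z r.rev)
  have hτ_mono : StrictMono τ := fun r s hrs =>
    Real.strictAntiOn_arccos (hz_mem _) (hz_mem _) (hz_mono (Fin.rev_lt_rev.2 hrs))
  have hτ (r) : τ r ∈ Set.Ioo 0 Real.pi :=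
    ⟨Real.arccos_pos.2 (hz _).1.2, Real.arccos_lt_pi.2 (hz _).1.1⟩
  refine ⟨unfoldedConfig m τ, unfoldedConfig_mem_configSpace hm hn hτ_mono hτ,
    isJacobiConfig_unfoldedConfig hm hn hp hτ_mono hτ fun r => ?_⟩
  rw [Real.cos_arccos (hz_mem _).1 (hz_mem _).2]
  exact (hz _).2

theorem hamiltonian_lt_of_isJacobiConfig (hm : 1 ≤ m) (hn : 1 ≤ n) {p q : ℝ} (hp : 0 < p)
    (hq : 0 < q) {x y : Config m n} (hx : x ∈ configSpace m n) (h : IsJacobiConfig p q x)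
    (hy : y ∈ configSpace m n) (hne : x ≠ y) :
    hamiltonian m n p q y < hamiltonian m n p q x :=
  hamiltonian_lt_of_isEquilibrium hm hn hp hq hx hy hne (h.isEquilibrium hm hn hp hx)

theorem isMaxOn_iff_isJacobiConfig (hm : 1 ≤ m) (hn : 1 ≤ n) {p q : ℝ} (hp : 0 < p)
    (hq : 0 < q) {x : Config m n} (hx : x ∈ configSpace m n) :
    IsMaxOn (hamiltonian m n p q) (configSpace m n) x ↔ IsJacobiConfig p q x := by
  refine ⟨fun hmax => ?_, fun h y hy => ?_⟩
  · obtain ⟨x₀, hx₀, h₀⟩ := exists_isJacobiConfig hm hn hp hq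
    obtain rfl : x₀ = x := by
      by_contra hne
      exact (hmax hx₀).not_gt (hamiltonian_lt_of_isJacobiConfig hm hn hp hq hx₀ h₀ hx hne)
    exact h₀
  · rcases eq_or_ne x y with rfl | hne
    · exact le_rfl (a := hamiltonian m n p q x)
    · exact (hamiltonian_lt_of_isJacobiConfig hm hn hp hq hx h hy hne).le

end JacobiConfig

theorem theorem1p1 (m n : ℕ) (hm : 1 ≤ m) (hn : 1 ≤ n) (p q : ℝ) (hp : 0 < p) (hq : 0 < q) :
    Convex ℝ (configSpace m n) ∧
    (∃! x : Config m n, x ∈ configSpace m n ∧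
      IsMaxOn (hamiltonian m n p q) (configSpace m n) x) ∧
    (∀ φ ψ : Fin m → ℝ, ∀ θ : Fin (2 * m * n) → ℝ, (φ, ψ, θ) ∈ configSpace m n →
      (IsMaxOn (hamiltonian m n p q) (configSpace m n) (φ, ψ, θ) ↔
        Set.range (fun j => circPt (φ j)) = {z : ℂ | z ^ m = 1} ∧
        Set.range (fun j => circPt (ψ j)) = {z : ℂ | z ^ m = -1} ∧
        Set.range (fun k => circPt (θ k)) =
          {z : ℂ | (circlePoly m n (jacobiPoly n (p - 1 / 2) (q - 1 / 2))).eval z = 0})) := by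
  obtain ⟨x₀, hx₀, h₀⟩ := exists_isJacobiConfig hm hn hp hq
  have isMaxOn_iff {x : Config m n} (hx : x ∈ configSpace m n) :=
    isMaxOn_iff_isJacobiConfig hm hn hp hq hx
  refine ⟨convex_configSpace m n, ⟨x₀, ⟨hx₀, (isMaxOn_iff hx₀).2 h₀⟩, ?_⟩,
    fun φ ψ θ hx => isMaxOn_iff hx⟩
  rintro y ⟨hy, hmax⟩
  by_contra hne
  exact (hmax hx₀).not_gt (hamiltonian_lt_of_isJacobiConfig hm hn hp hq hx₀ h₀ hy (Ne.symm hne))
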